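/- Let $H$ be a Hardy field, that is, a set of germs at $+\infty$ of functions $\mathbb{R}\to\mathbb{R}$ which is a field (under pointwise operations on germs) and is closed under differentiation. Suppose that $H$ carries the exponential, i.e. for every $f\in H$ the germ $\exp(f)$ of $x\mapsto e^{f(x)}$ belongs to $H$. Let $C=\{f\in H : f'=0\}$ be the field of constants of $H$. Let $n\ge 1$ and let $f_1,\dots,f_n\in H$ be such that the limits $\lim_{x\to+\infty}f_i(x)$ exist in $\mathbb{R}$. If the germs $$f_1-\lim_{x\to+\infty}f_1(x),\ \dots,\ f_n-\lim_{x\to+\infty}f_n(x)$$ are $\mathbb{Q}$-linearly independent, then $$\operatorname{td}_C C\bigl(f_1,\dots,f_n,\exp(f_1),\dots,\exp(f_n)\bigr)\ \ge\ n+1,$$ where $\operatorname{td}_C$ denotes the transcendence degree over $C$. -/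

import Mathlib

open Filter Topology

/-- The ring of germs at `+∞` of functions `ℝ → ℝ`, with pointwise operations. -/
abbrev RealGerm : Type := Germ (atTop : Filter ℝ) ℝ

namespace RealGerm

/-- `g` is the derivative of the germ `f`: some (equivalently, any) representative `F` of `f` is
differentiable at all large `x`, with derivative there given by a representative of `g`. -/
def HasDeriv (f g : RealGerm) : Prop :=
  ∃ F G : ℝ → ℝ, f = (F : RealGerm) ∧ g = (G : RealGerm) ∧ ∀ᶠ x in atTop, HasDerivAt F (G x) x

/-- The germ of `x ↦ exp (f x)`. -/
noncomputable def exp (f : RealGerm) : RealGerm := Germ.map Real.exp f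

theorem hasDeriv_coe {F : ℝ → ℝ} {g : RealGerm} :
    HasDeriv (F : RealGerm) g ↔
      ∃ G : ℝ → ℝ, g = (G : RealGerm) ∧ ∀ᶠ x in atTop, HasDerivAt F (G x) x := by
  constructor
  · rintro ⟨F', G, hF, hG, h⟩
    refine ⟨G, hG, ?_⟩
    obtain ⟨a, ha⟩ := eventually_atTop.1 (Germ.coe_eq.1 hF)
    filter_upwards [h, eventually_gt_atTop a] with x hx hax
    refine hx.congr_of_eventuallyEq ?_
    filter_upwards [Ioi_mem_nhds hax] with y hy
    exact ha y (le_of_lt hy)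
  · rintro ⟨G, hG, h⟩
    exact ⟨F, G, rfl, hG, h⟩

theorem HasDeriv.unique {f g g' : RealGerm} (h : HasDeriv f g) (h' : HasDeriv f g') : g = g' := by
  obtain ⟨F, G, rfl, rfl, h⟩ := h
  obtain ⟨G', rfl, hG'⟩ := hasDeriv_coe.1 h'
  refine Germ.coe_eq.2 ?_
  filter_upwards [h, hG'] with x hx hx'
  exact hx.unique hx'

theorem HasDeriv.add {f g f' g' : RealGerm} (hf : HasDeriv f f') (hg : HasDeriv g g') :
    HasDeriv (f + g) (f' + g') := by
  obtain ⟨F, F', rfl, rfl, hf⟩ := hf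
  obtain ⟨G, G', rfl, rfl, hg⟩ := hg
  refine ⟨F + G, F' + G', rfl, rfl, ?_⟩
  filter_upwards [hf, hg] with x hx hx'
  exact hx.add hx'

theorem HasDeriv.mul {f g f' g' : RealGerm} (hf : HasDeriv f f') (hg : HasDeriv g g') :
    HasDeriv (f * g) (f' * g + f * g') := by
  obtain ⟨F, F', rfl, rfl, hf⟩ := hf
  obtain ⟨G, G', rfl, rfl, hg⟩ := hg
  refine ⟨F * G, F' * G + F * G', rfl, rfl, ?_⟩
  filter_upwards [hf, hg] with x hx hx'
  exact hx.mul hx'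

theorem hasDeriv_const (c : ℝ) : HasDeriv (Germ.const c) 0 :=
  ⟨fun _ => c, 0, rfl, rfl, Eventually.of_forall fun x => hasDerivAt_const x c⟩

end RealGerm

/-- A Hardy field: a set of germs at `+∞` of real functions which is a field (under the operations
of the ring of germs) and is closed under differentiation. In particular every germ in it is
differentiable near `+∞`. -/
structure HardyField extends Subring RealGerm where
  exists_mul_eq_one : ∀ f ∈ carrier, f ≠ 0 → ∃ g ∈ carrier, f * g = 1
  exists_hasDeriv : ∀ f ∈ carrier, ∃ g ∈ carrier, RealGerm.HasDeriv f g

namespace HardyField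

instance : CoeSort HardyField Type := ⟨fun H => H.toSubring⟩

noncomputable instance (H : HardyField) : Field H :=
  IsField.toField (R := H.toSubring)
    { exists_pair_ne := exists_pair_ne _
      mul_comm := mul_comm
      mul_inv_cancel := by
        rintro ⟨f, hf⟩ h
        obtain ⟨g, hg, hfg⟩ := H.exists_mul_eq_one f hf fun h0 => h (Subtype.ext h0)
        exact ⟨⟨g, hg⟩, Subtype.ext hfg⟩ }

/-- The field of constants of a Hardy field: its elements with zero derivative. -/
noncomputable def constants (H : HardyField) : Subfield H where
  carrier := {f | RealGerm.HasDeriv (f : RealGerm) 0}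
  zero_mem' := RealGerm.hasDeriv_const 0
  one_mem' := RealGerm.hasDeriv_const 1
  add_mem' {f g} hf hg := by
    have h := RealGerm.HasDeriv.add hf hg
    rwa [add_zero] at h
  mul_mem' {f g} hf hg := by
    have h := RealGerm.HasDeriv.mul hf hg
    rwa [zero_mul, mul_zero, add_zero] at h
  neg_mem' {f} hf := by
    have h := RealGerm.HasDeriv.mul (RealGerm.hasDeriv_const (-1)) hf
    rw [zero_mul, mul_zero, add_zero] at h
    have h1 : (Germ.const (-1) : RealGerm) = -1 := rfl
    rw [h1, neg_one_mul] at h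
    exact h
  inv_mem' f hf := by
    by_cases h0 : f = 0
    · subst h0
      rw [inv_zero]
      exact RealGerm.hasDeriv_const 0
    · obtain ⟨g, hg, hd⟩ := H.exists_hasDeriv _ (f⁻¹).2
      have hmul : (f : RealGerm) * ((f⁻¹ : H) : RealGerm) = 1 :=
        congrArg Subtype.val (mul_inv_cancel₀ h0)
      have h := RealGerm.HasDeriv.mul hf hd
      rw [hmul, zero_mul, zero_add] at h
      have hz : (f : RealGerm) * g = 0 := h.unique (RealGerm.hasDeriv_const 1)
      have hg0 : g = 0 := by
        calc g = ((f : RealGerm) * ((f⁻¹ : H) : RealGerm)) * g := by rw [hmul, one_mul]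
          _ = ((f⁻¹ : H) : RealGerm) * ((f : RealGerm) * g) := by ring
          _ = 0 := by rw [hz, mul_zero]
      rw [hg0] at hd
      exact hd

/-- The Hardy field `H` carries the exponential: `exp ∘ f` lies in `H` for every `f` in `H`. -/
def IsExponential (H : HardyField) : Prop :=
  ∀ f : H, RealGerm.exp (f : RealGerm) ∈ H.toSubring

/-- The exponential `f ↦ exp ∘ f` of an exponential Hardy field, as a map from `H` to `H`. -/
noncomputable def IsExponential.exp {H : HardyField} (hH : H.IsExponential) (f : H) : H :=
  ⟨RealGerm.exp (f : RealGerm), hH f⟩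

end HardyField

/-! This is Ax's theorem for the single derivation `D` of `H`, with `y i = f i`, `z i = exp (f i)`.
If the transcendence degree were at most `n`, the differentials of the `y i`, `z i` would span a
space `W` of dimension at most `n`. The forms `ω i = dz i / z i - dy i` lie in `W` and are killed by
`D`, but `dy i` is not, so the `ω i` are dependent. Their relations are stable under `D`, so a
shortest one has constant coefficients (`exists_relation_const_coeff`). On a ℤ-basis `e` of the
group these generate, the relation reads `∑ e j * dw j / w j = dv`, where the `w j` are monomials in
the `z i`. A residue argument (`isAlgebraic_of_sum_logForm_exact`) makes each `w j` algebraic over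
`C`, so an integer combination of the `y i` has derivative zero. In a Hardy field it is then equal
to its limit, which contradicts the independence of the `f i - lim f i`. -/

namespace Derivation

/-! ### Derivations along algebraic extensions. -/

section

variable {R E K M : Type*} [CommRing R] [Field E] [Field K] [Algebra R K] [Algebra E K]
  [AddCommGroup M] [Module K M] [Module R M] [Module E M]

theorem apply_eq_zero_of_isAlgebraic [CharZero E] (δ : Derivation E K M) {a : K}
    (ha : IsAlgebraic E a) : δ a = 0 := by
  have h := δ.map_aeval (minpoly E a) a
  rw [minpoly.aeval, map_zero] at h
  exact (smul_eq_zero.1 h.symm).resolve_left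
    ((minpoly.irreducible ha.isIntegral).separable.aeval_derivative_ne_zero (minpoly.aeval E a))

variable [IsScalarTower E K M]

/-- A derivation vanishing on a subfield is linear over it. -/
def extendScalars (δ : Derivation R K M) (h : ∀ x : E, δ (algebraMap E K x) = 0) :
    Derivation E K M :=
  Derivation.mk'
    { toFun := δ
      map_add' := map_add δ
      map_smul' := fun e x => by
        rw [Algebra.smul_def, leibniz, h, smul_zero, add_zero, RingHom.id_apply, algebraMap_smul] }
    fun a b => δ.leibniz a b

theorem apply_eq_zero_of_apply_algebraMap_eq_zero [CharZero E] [Algebra.IsAlgebraic E K]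
    (δ : Derivation R K M) (h : ∀ x : E, δ (algebraMap E K x) = 0) (a : K) : δ a = 0 :=
  (δ.extendScalars h).apply_eq_zero_of_isAlgebraic (Algebra.IsAlgebraic.isAlgebraic a)

end

section

variable {R E K : Type*} [CommRing R] [Field E] [Field K] [Algebra R E] [Algebra R K]
  [Algebra E K] [IsScalarTower R E K] [CharZero E] [Algebra.IsAlgebraic E K]

/-- Algebraic extensions in characteristic zero are formally étale, so `Ω[K⁄R]` is the base change
of `Ω[E⁄R]`, and so is the linear form attached to `d`. -/
theorem exists_extension_of_isAlgebraic (d : Derivation R E E) :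
    ∃ d' : Derivation R K K, ∀ x, d' (algebraMap E K x) = algebraMap E K (d x) := by
  have : Algebra.FormallyEtale E K := Algebra.FormallyEtale.of_isSeparable E K
  let l : Ω[E⁄R] →ₗ[E] K := ((Algebra.linearMap E K).compDer d).liftKaehlerDifferential
  refine ⟨((l.liftBaseChange K) ∘ₗ
    (KaehlerDifferential.tensorKaehlerEquivOfFormallyEtale R E K).symm.toLinearMap).compDer
      (KaehlerDifferential.D R K), fun x => ?_⟩
  simp [l, KaehlerDifferential.tensorKaehlerEquivOfFormallyEtale_symm_D_algebraMap]

/-- The conjugate of `d'` by `τ` extends the same `d`, and extensions are unique. -/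
theorem algEquiv_apply_of_isAlgebraic {d : Derivation R E E} {d' : Derivation R K K}
    (h : ∀ x, d' (algebraMap E K x) = algebraMap E K (d x)) (τ : K ≃ₐ[E] K) (a : K) :
    d' (τ a) = τ (d' a) := by
  let δ : Derivation R K K := Derivation.mk'
    ((τ.symm.toLinearMap.restrictScalars R) ∘ₗ d'.toLinearMap ∘ₗ (τ.toLinearMap.restrictScalars R))
    fun a b => by simp
  have hδ : ∀ x, δ x = τ.symm (d' (τ x)) := fun _ => rfl
  have h0 := (δ - d').apply_eq_zero_of_apply_algebraMap_eq_zero (E := E) (fun x => by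
    simp [hδ, h]) a
  have h1 : τ.symm (d' (τ a)) = d' a := by simpa [hδ, sub_eq_zero] using h0
  rw [← h1, AlgEquiv.apply_symm_apply]

end

theorem apply_prod_div {R K ι : Type*} [CommRing R] [Field K] [Algebra R K] (d : Derivation R K K)
    (s : Finset ι) (f : ι → K) (hf : ∀ i ∈ s, f i ≠ 0) :
    d (∏ i ∈ s, f i) / ∏ i ∈ s, f i = ∑ i ∈ s, d (f i) / f i := by
  classical
  induction s using Finset.induction_on with
  | empty => simp
  | insert i s hi ih =>
    have h1 := hf i (Finset.mem_insert_self i s)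
    have h2 : ∀ j ∈ s, f j ≠ 0 := fun j hj => hf j (Finset.mem_insert_of_mem hj)
    have h3 : ∏ j ∈ s, f j ≠ 0 := Finset.prod_ne_zero_iff.2 h2
    rw [Finset.prod_insert hi, Finset.sum_insert hi, ← ih h2, leibniz, smul_eq_mul, smul_eq_mul]
    field_simp
    ring

/-- An additive map satisfying the Leibniz rule, as a derivation over `ℤ`. -/
def ofAddMonoidHom {A : Type*} [CommRing A] (f : A →+ A)
    (h : ∀ a b, f (a * b) = a * f b + b * f a) : Derivation ℤ A A :=
  Derivation.mk' f.toIntLinearMap h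

/-- A linear combination of logarithmic derivatives that is a derivative descends along an
algebraic extension, by taking norms and traces. -/
theorem exists_descent_of_sum_logDeriv {R E K κ : Type*} [CommRing R] [Field E] [Field K]
    [Algebra R E] [Algebra R K] [Algebra E K] [IsScalarTower R E K] [CharZero E]
    [Algebra.IsAlgebraic E K] [IsAlgClosed K] [Fintype κ]
    {d : Derivation R E E} {d' : Derivation R K K}
    (h : ∀ x, d' (algebraMap E K x) = algebraMap E K (d x))
    (e : κ → E) (w : κ → K) (hw : ∀ j, w j ≠ 0) (v : K)
    (hv : ∑ j, algebraMap E K (e j) * (d' (w j) / w j) = d' v) :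
    ∃ (m : ℕ) (N : κ → E) (s : E), m ≠ 0 ∧ (∀ j, N j ≠ 0) ∧
      (∀ j x, w j = algebraMap E K x → N j = x ^ m) ∧ ∑ j, e j * (d (N j) / N j) = d s := by
  classical
  let L := IntermediateField.adjoin E (Set.range w ∪ {v})
  have hfin : FiniteDimensional E L := by
    have : Finite (Set.range w ∪ {v} : Set K) :=
      ((Set.finite_range w).union (Set.finite_singleton v)).to_subtype
    exact IntermediateField.finiteDimensional_adjoin
      fun x _ => (Algebra.IsAlgebraic.isAlgebraic x).isIntegral
  have hwL : ∀ j, w j ∈ L := fun j => IntermediateField.subset_adjoin E _ (Or.inl ⟨j, rfl⟩)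
  have hvL : v ∈ L := IntermediateField.subset_adjoin E _ (Or.inr rfl)
  let w' : κ → L := fun j => ⟨w j, hwL j⟩
  let v' : L := ⟨v, hvL⟩
  have hw' : ∀ j, w' j ≠ 0 := fun j h0 => hw j (congrArg Subtype.val h0)
  -- Embeddings of `L` extend to automorphisms of `K`, which commute with `d'`, so every conjugate
  -- of the relation holds. Summing them gives norms and a trace.
  have hσ : ∀ σ : L →ₐ[E] K,
      ∑ j, algebraMap E K (e j) * (d' (σ (w' j)) / σ (w' j)) = d' (σ v') := by
    intro σ
    have : Normal E K := { splits' := fun _ => IsAlgClosed.splits _ }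
    let τ : K ≃ₐ[E] K := AlgEquiv.ofBijective (σ.liftNormal K)
      (Algebra.IsAlgebraic.algHom_bijective _)
    have hτ : ∀ x : L, σ x = τ (x : K) := fun x => (σ.liftNormal_commutes K x).symm
    have := congrArg τ hv
    rw [map_sum, ← algEquiv_apply_of_isAlgebraic h] at this
    simp only [map_mul, map_div₀, AlgEquiv.commutes, ← algEquiv_apply_of_isAlgebraic h] at this
    simpa only [hτ] using this
  refine ⟨Module.finrank E L, fun j => Algebra.norm E (w' j), Algebra.trace E L v',
    Module.finrank_pos.ne', fun j => Algebra.norm_ne_zero_iff.2 (hw' j), fun j x hx => ?_, ?_⟩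
  · have : w' j = algebraMap E L x := Subtype.ext hx
    beta_reduce
    rw [this, Algebra.norm_algebraMap]
  · apply (algebraMap E K).injective
    rw [← h, trace_eq_sum_embeddings K, map_sum, map_sum]
    simp_rw [← hσ]
    rw [Finset.sum_comm]
    refine Finset.sum_congr rfl fun j _ => ?_
    rw [map_mul, map_div₀, ← h, Algebra.norm_eq_prod_embeddings E K, apply_prod_div,
      Finset.mul_sum]
    exact fun σ _ => (map_ne_zero σ).2 (hw' j)

end Derivation

/-! ### The Euler derivation on Laurent series. -/

namespace LaurentSeries

variable {k : Type*} [Field k]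

/-- The additive map multiplying the coefficient of `X ^ n` by `n`. -/
noncomputable def eulerHom : LaurentSeries k →+ LaurentSeries k where
  toFun x :=
    { coeff := fun n => (n : k) * x.coeff n
      isPWO_support' := x.isPWO_support'.mono fun n hn => right_ne_zero_of_mul hn }
  map_zero' := by ext n; simp
  map_add' x y := by ext n; simp [mul_add]

theorem coeff_eulerHom (x : LaurentSeries k) (n : ℤ) :
    (eulerHom x).coeff n = (n : k) * x.coeff n := rfl

theorem support_eulerHom_subset (x : LaurentSeries k) : (eulerHom x).support ⊆ x.support :=
  fun _ hn => right_ne_zero_of_mul hn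

theorem eulerHom_mul (x y : LaurentSeries k) :
    eulerHom (x * y) = x * eulerHom y + y * eulerHom x := by
  ext n
  rw [HahnSeries.coeff_add,
    HahnSeries.coeff_mul_right' y.isPWO_support (support_eulerHom_subset y), mul_comm y,
    HahnSeries.coeff_mul_left' x.isPWO_support (support_eulerHom_subset x),
    ← Finset.sum_add_distrib, coeff_eulerHom, HahnSeries.coeff_mul, Finset.mul_sum]
  refine Finset.sum_congr rfl fun ij hij => ?_
  rw [coeff_eulerHom, coeff_eulerHom, ← (Finset.mem_antidiagonal.1 hij).2.2]
  push_cast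
  ring

/-- Compare the coefficients of degree `x.order` in `eulerHom x = x * g`. Since `x.order` may vanish
in `k`, `g` can be zero or of positive order. -/
theorem coeff_zero_eulerHom_div {x : LaurentSeries k} (hx : x ≠ 0) :
    (eulerHom x / x).coeff 0 = (x.order : k) := by
  set g := eulerHom x / x with hg
  have hxg : eulerHom x = x * g := by rw [hg, mul_div_cancel₀ _ hx]
  have hlc : x.leadingCoeff ≠ 0 := HahnSeries.leadingCoeff_ne_zero.2 hx
  have hc : (x * g).coeff x.order = (x.order : k) * x.leadingCoeff := by
    rw [← hxg, coeff_eulerHom, HahnSeries.leadingCoeff_eq]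
  by_cases hg0 : g = 0
  · rw [hg0, mul_zero, HahnSeries.coeff_zero, eq_comm, mul_eq_zero] at hc
    rw [hg0, HahnSeries.coeff_zero, hc.resolve_right hlc]
  have hord : 0 ≤ g.order := by
    have h1 : (eulerHom x).coeff (x.order + g.order) ≠ 0 := by
      rw [hxg, HahnSeries.coeff_mul_order_add_order]
      exact mul_ne_zero hlc (HahnSeries.leadingCoeff_ne_zero.2 hg0)
    rw [coeff_eulerHom] at h1
    have := HahnSeries.order_le_of_coeff_ne_zero (right_ne_zero_of_mul h1)
    omega
  rcases hord.eq_or_lt with h0 | h0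
  · have := HahnSeries.coeff_mul_order_add_order x g
    rw [← h0, add_zero, hc, HahnSeries.leadingCoeff_eq (x := g), ← h0, mul_comm] at this
    exact (mul_left_cancel₀ hlc this).symm
  · rw [HahnSeries.coeff_eq_zero_of_lt_order (by rw [HahnSeries.order_mul hx hg0]; omega),
      eq_comm, mul_eq_zero] at hc
    rw [HahnSeries.coeff_eq_zero_of_lt_order h0, hc.resolve_right hlc]

theorem eulerHom_C (a : k) : eulerHom (HahnSeries.C a : LaurentSeries k) = 0 := by
  ext n
  by_cases hn : n = 0 <;> simp [coeff_eulerHom, HahnSeries.C_apply, hn]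

theorem eulerHom_single_one :
    eulerHom (HahnSeries.single 1 1 : LaurentSeries k) = HahnSeries.single 1 1 := by
  ext n
  by_cases hn : n = 1 <;> simp [coeff_eulerHom, hn]

end LaurentSeries

open Polynomial in
/-- The properties of the field of Laurent series used below: it contains the polynomials, carries
the Euler derivation `d = X d/dX`, and its constant coefficient `ρ` kills derivatives and takes
integer values on logarithmic derivatives. -/
theorem exists_field_with_eulerDerivation.{u} (k : Type u) [Field k] [CharZero k] :
    ∃ (Λ : Type u) (_ : Field Λ) (_ : CharZero Λ) (ι : k[X] →+* Λ) (d : Derivation ℤ Λ Λ)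
      (ρ : Λ →+ k), Function.Injective ι ∧ (∀ a, d (ι (C a)) = 0) ∧ d (ι X) = ι X ∧ ρ 1 = 1 ∧
        (∀ a x, ρ (ι (C a) * x) = a * ρ x) ∧ (∀ x, ρ (d x) = 0) ∧
        ∀ x, x ≠ 0 → ∃ n : ℤ, ρ (d x / x) = n := by
  let ι : k[X] →+* LaurentSeries k := (HahnSeries.ofPowerSeries ℤ k).comp coeToPowerSeries.ringHom
  have hC : ∀ a, ι (C a) = HahnSeries.C a := fun a => by
    simp [ι]
  have hX : ι X = HahnSeries.single 1 1 := by
    simp [ι]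
  have hinj : Function.Injective ι :=
    HahnSeries.ofPowerSeries_injective.comp (coe_injective k)
  let ρ : LaurentSeries k →+ k :=
    { toFun := fun x => x.coeff 0
      map_zero' := rfl
      map_add' := fun _ _ => rfl }
  have hchar : CharZero (LaurentSeries k) :=
    charZero_of_injective_ringHom (f := (HahnSeries.C : k →+* LaurentSeries k))
      HahnSeries.C_injective
  have key := fun x : LaurentSeries k => LaurentSeries.coeff_zero_eulerHom_div (x := x)
  refine ⟨LaurentSeries k, inferInstance, hchar, ι,
    Derivation.ofAddMonoidHom LaurentSeries.eulerHom LaurentSeries.eulerHom_mul,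
    ρ, hinj, fun a => ?_, ?_, ?_, fun a x => ?_, fun x => ?_, fun x hx => ⟨x.order, key x hx⟩⟩
  · exact (congrArg _ (hC a)).trans (LaurentSeries.eulerHom_C a)
  · exact (congrArg _ hX).trans (LaurentSeries.eulerHom_single_one.trans hX.symm)
  · simp [ρ]
  · rw [hC]
    exact HahnSeries.coeff_single_zero_mul
  · change ((0 : ℤ) : k) * x.coeff 0 = 0
    simp

/-! ### Exact logarithmic forms, by residues. -/

/-- A combination of logarithmic differentials with `ℤ`-independent constant coefficients is exact
only if the functions involved are algebraic over the ground field. -/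
theorem isAlgebraic_of_sum_logForm_exact {C F κ : Type*} [Field C] [Field F] [Algebra C F]
    [CharZero F] [Fintype κ] (e : κ → C) (he : LinearIndependent ℤ e) (w : κ → F)
    (hw : ∀ j, w j ≠ 0) (v : F)
    (h : ∑ j, algebraMap C F (e j) • (w j)⁻¹ • KaehlerDifferential.D C F (w j) =
      KaehlerDifferential.D C F v) (j₀ : κ) : IsAlgebraic C (w j₀) := by
  classical
  by_contra htr
  obtain ⟨B, hwB, hB⟩ := exists_isTranscendenceBasis_superset (R := C) (s := {w j₀})
    (algebraicIndependent_unique_type_iff.2 htr)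
  obtain ⟨Λ, _, _, ι, d, ρ, hι, hdC, hdX, hρ1, hρC, hρd, hρlog⟩ :=
    exists_field_with_eulerDerivation F
  let K := AlgebraicClosure Λ
  obtain ⟨d', hd'⟩ := d.exists_extension_of_isAlgebraic (K := K)
  -- the embedding of the polynomial ring on the transcendence basis into `Λ`
  let g₀ : MvPolynomial B C →+* Polynomial F := MvPolynomial.eval₂Hom
    (Polynomial.C.comp (algebraMap C F))
    fun b => if (b : F) = w j₀ then Polynomial.C (b : F) * Polynomial.X else Polynomial.C (b : F)
  -- Setting `X = 1` undoes the scaling of `w j₀` and recovers the inclusion of the basis.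
  have hg₀ : Function.Injective g₀ := by
    have hcomp : (Polynomial.evalRingHom (1 : F)).comp g₀ =
        (MvPolynomial.aeval (R := C) ((↑) : B → F)).toRingHom := by
      refine MvPolynomial.ringHom_ext (fun r => by simp [g₀]) fun b => ?_
      by_cases hb : (b : F) = w j₀ <;> simp [g₀, hb]
    have : Function.Injective ((Polynomial.evalRingHom (1 : F)).comp g₀) := by
      rw [hcomp]; exact hB.1
    exact Function.Injective.of_comp this
  let A := Algebra.adjoin C (Set.range ((↑) : B → F))
  let g : A →+* K := ((algebraMap Λ K).comp (ι.comp g₀)).comp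
    (hB.1.aevalEquiv.symm : A →+* MvPolynomial B C)
  have hg : Function.Injective g :=
    ((algebraMap Λ K).injective.comp (hι.comp hg₀)).comp hB.1.aevalEquiv.symm.injective
  let : Algebra A K := g.toAlgebra
  have : FaithfulSMul A K := (faithfulSMul_iff_algebraMap_injective A K).2 hg
  have := hB.isAlgebraic
  let φ : F →ₐ[A] K := IsAlgClosed.lift
  have hφA : ∀ p : MvPolynomial B C, φ (MvPolynomial.aeval ((↑) : B → F) p) =
      algebraMap Λ K (ι (g₀ p)) := by
    intro p
    have h1 := φ.commutes (hB.1.aevalEquiv p)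
    have h2 : algebraMap A F (hB.1.aevalEquiv p) = MvPolynomial.aeval ((↑) : B → F) p := by
      simp
    rw [h2] at h1
    rw [h1]
    change g _ = _
    simp [g]
  have hφC : ∀ c : C, φ (algebraMap C F c) = algebraMap Λ K (ι (Polynomial.C (algebraMap C F c))) := by
    intro c
    have := hφA (MvPolynomial.C c)
    simpa [g₀] using this
  have hφw : φ (w j₀) = algebraMap Λ K (ι (Polynomial.C (w j₀) * Polynomial.X)) := by
    have := hφA (MvPolynomial.X ⟨w j₀, hwB rfl⟩)
    simpa [g₀] using this
  -- pull the relation between differentials back to `K`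
  have hrel : ∑ j, algebraMap Λ K (ι (Polynomial.C (algebraMap C F (e j)))) *
      (d' (φ (w j)) / φ (w j)) = d' (φ v) := by
    let : Algebra F K := φ.toRingHom.toAlgebra
    let : Algebra C K := ((φ : F →+* K).comp (algebraMap C F)).toAlgebra
    have : IsScalarTower C F K := IsScalarTower.of_algebraMap_eq fun _ => rfl
    let D₀ : Derivation ℤ F K := d'.compAlgebraMap F
    -- `d' ∘ φ` is `C`-linear because the Euler derivation kills constant series, so it factors
    -- through `Ω[F⁄C]`.
    let D₁ : Derivation C F K := D₀.extendScalars fun c => by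
      change d' (φ (algebraMap C F c)) = 0
      rw [hφC, hd', hdC, map_zero]
    have hD₁ : ∀ x, D₁ x = d' (φ x) := fun _ => rfl
    have h1 := congrArg D₁.liftKaehlerDifferential h
    simp only [map_sum, map_smul, Derivation.liftKaehlerDifferential_comp_D, hD₁] at h1
    rw [← h1]
    refine Finset.sum_congr rfl fun j _ => ?_
    rw [← hφC, Algebra.smul_def, Algebra.smul_def]
    change _ = φ _ * (φ _ * _)
    rw [map_inv₀, div_eq_inv_mul]
  obtain ⟨m, N, s, hm, hN, hNm, hNs⟩ := Derivation.exists_descent_of_sum_logDeriv hd'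
    _ _ (fun j => (map_ne_zero φ).2 (hw j)) _ hrel
  choose n hn using fun j => hρlog (N j) (hN j)
  have h0 := congrArg ρ hNs
  simp only [map_sum, hρC, hρd, hn] at h0
  have h1 : ∑ j, n j • e j = 0 := by
    apply (algebraMap C F).injective
    rw [map_sum, map_zero, ← h0]
    exact Finset.sum_congr rfl fun j _ => by rw [zsmul_eq_mul, map_mul, map_intCast, mul_comm]
  have h2 : n j₀ = 0 := Fintype.linearIndependent_iff.1 he n h1 j₀
  -- `N j₀` is the `m`-th power of `w j₀ * X`, whose logarithmic derivative is `1`. This forces `n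
  -- j₀ = m ≠ 0`.
  have h3 := hn j₀
  have hx : ι (Polynomial.C (w j₀) * Polynomial.X) ≠ 0 :=
    (map_ne_zero_iff ι hι).2 (mul_ne_zero (Polynomial.C_ne_zero.2 (hw j₀)) Polynomial.X_ne_zero)
  have hdx : d (ι (Polynomial.C (w j₀) * Polynomial.X)) =
      ι (Polynomial.C (w j₀) * Polynomial.X) := by
    rw [map_mul, Derivation.leibniz, hdC, hdX, smul_zero, add_zero, smul_eq_mul]
  rw [hNm j₀ _ hφw, h2, Derivation.leibniz_pow, hdx, smul_eq_mul, ← pow_succ,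
    Nat.sub_add_cancel (Nat.pos_of_ne_zero hm), nsmul_eq_mul, mul_div_assoc,
    div_self (pow_ne_zero m hx), ← nsmul_eq_mul, map_nsmul, hρ1, nsmul_one, Int.cast_zero,
    Nat.cast_eq_zero] at h3
  exact hm h3

/-! ### Ax's theorem for one derivation. -/

section

variable {C F : Type*} [Field C] [Field F] [Algebra C F]

/-- A family of vectors whose linear relations are stable under a derivation of the scalars is
linearly dependent over the constants as soon as it is dependent. -/
theorem exists_relation_const_coeff {V : Type*} [AddCommGroup V] [Module F V]
    (D : Derivation C F F) {n : ℕ} (ω : Fin n → V)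
    (hD : ∀ a : Fin n → F, ∑ i, a i • ω i = 0 → ∑ i, D (a i) • ω i = 0)
    (hdep : ¬ LinearIndependent F ω) :
    ∃ a : Fin n → F, a ≠ 0 ∧ ∑ i, a i • ω i = 0 ∧ ∀ i, D (a i) = 0 := by
  classical
  let P : ℕ → Prop := fun k => ∃ a : Fin n → F, a ≠ 0 ∧ ∑ i, a i • ω i = 0 ∧
    (Finset.univ.filter fun i => a i ≠ 0).card = k
  have hP : ∃ k, P k := by
    obtain ⟨a, ha, i, hi⟩ := Fintype.not_linearIndependent_iff.1 hdep
    exact ⟨_, a, fun h0 => hi (congrFun h0 i), ha, rfl⟩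
  obtain ⟨a, ha0, ha, hcard⟩ := Nat.find_spec hP
  obtain ⟨i₀, hi₀⟩ := Function.ne_iff.1 ha0
  -- In a relation of minimal support, normalise one coefficient to `1`: `D` kills it, so the
  -- differentiated relation is shorter and must be trivial.
  let b : Fin n → F := fun i => (a i₀)⁻¹ * a i
  have hb : ∑ i, b i • ω i = 0 := by
    simp only [b, mul_smul, ← Finset.smul_sum, ha, smul_zero]
  have hb1 : b i₀ = 1 := inv_mul_cancel₀ hi₀
  refine ⟨b, fun h0 => by simp [h0] at hb1, hb, fun i => ?_⟩
  by_contra hi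
  refine Nat.find_min hP ?_ ⟨fun i => D (b i), fun h0 => hi (congrFun h0 i), hD b hb, rfl⟩
  rw [← hcard]
  refine Finset.card_lt_card (Finset.ssubset_iff_of_subset ?_ |>.2 ⟨i₀, ?_, ?_⟩)
  · intro j hj
    rw [Finset.mem_filter] at hj ⊢
    refine ⟨hj.1, fun h0 => hj.2 ?_⟩
    simp [b, h0]
  · exact Finset.mem_filter.2 ⟨Finset.mem_univ _, hi₀⟩
  · simp [hb1]

/-- The relations between the forms `dz / z - dy` attached to solutions of `D z = z D y` are
stable under `D`. -/
theorem sum_derivation_smul_logForm_eq_zero (D : Derivation C F F) {n : ℕ} (y z : Fin n → F)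
    (hz : ∀ i, z i ≠ 0) (hyz : ∀ i, D (z i) = z i * D (y i)) (a : Fin n → F)
    (ha : ∑ i, a i • ((z i)⁻¹ • KaehlerDifferential.D C F (z i) -
      KaehlerDifferential.D C F (y i)) = 0) :
    ∑ i, D (a i) • ((z i)⁻¹ • KaehlerDifferential.D C F (z i) -
      KaehlerDifferential.D C F (y i)) = 0 := by
  rw [← Module.forall_dual_apply_eq_zero_iff F]
  intro ℓ
  let δ : Derivation C F F := ℓ.compDer (KaehlerDifferential.D C F)
  have hval : ∀ (δ : Derivation C F F) (b : Fin n → F),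
      δ.liftKaehlerDifferential (∑ i, b i • ((z i)⁻¹ • KaehlerDifferential.D C F (z i) -
        KaehlerDifferential.D C F (y i))) = ∑ i, b i * ((z i)⁻¹ * δ (z i) - δ (y i)) := by
    intro δ b
    simp [Derivation.liftKaehlerDifferential_comp_D]
  have hℓ : ℓ = δ.liftKaehlerDifferential := by
    apply Derivation.liftKaehlerDifferential_unique
    ext x
    simp [δ]
  have h1 := hval δ a
  -- The commutator is again a derivation, so it too annihilates the relation. Since `D z / z = D
  -- y`, it accounts for all of the differentiated relation except the terms with `D (a i)`.
  have h2 := hval ⁅D, δ⁆ a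
  rw [ha, map_zero] at h1 h2
  rw [hℓ, hval]
  have h3 := congrArg D h1
  rw [map_zero, map_sum] at h3
  have h4 : ∀ i, D (a i * ((z i)⁻¹ * δ (z i) - δ (y i))) =
      D (a i) * ((z i)⁻¹ * δ (z i) - δ (y i)) +
        a i * ((z i)⁻¹ * ⁅D, δ⁆ (z i) - ⁅D, δ⁆ (y i)) := by
    intro i
    have := hz i
    simp only [Derivation.leibniz, Derivation.leibniz_inv, Derivation.commutator_apply, map_sub,
      smul_eq_mul, hyz]
    field_simp
    ring
  rw [Finset.sum_congr rfl fun i _ => h4 i, Finset.sum_add_distrib, ← h2, add_zero] at h3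
  exact h3.symm

/-- The differentials of the elements of an intermediate field span a space whose dimension is at
most the transcendence degree. -/
theorem exists_submodule_finrank_le_trdeg [CharZero F] (K : IntermediateField C F) {n : ℕ}
    (h : Algebra.trdeg C K ≤ n) :
    ∃ W : Submodule F (Ω[F⁄C]), FiniteDimensional F W ∧ Module.finrank F W ≤ n ∧
      ∀ x ∈ K, KaehlerDifferential.D C F x ∈ W := by
  obtain ⟨s, hs⟩ := exists_isTranscendenceBasis C K
  have hcard : Cardinal.mk s ≤ n := hs.cardinalMk_eq_trdeg.trans_le h
  have : Finite s := Cardinal.mk_lt_aleph0_iff.1 (hcard.trans_lt (Cardinal.natCast_lt_aleph0))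
  have := Fintype.ofFinite s
  rw [Cardinal.mk_fintype, Nat.cast_le] at hcard
  let f : s → Ω[F⁄C] := fun t => KaehlerDifferential.D C F ((t : K) : F)
  let W := Submodule.span F (Set.range f)
  refine ⟨W, FiniteDimensional.span_of_finite F (Set.finite_range f),
    (finrank_range_le_card f).trans hcard, fun x hx => ?_⟩
  -- Modulo `W` the universal derivation kills the transcendence basis, hence everything algebraic
  -- over the field it generates.
  let D₀ : Derivation C F (Ω[F⁄C] ⧸ W) := W.mkQ.compDer (KaehlerDifferential.D C F)
  let D₁ : Derivation C K (Ω[F⁄C] ⧸ W) := D₀.compAlgebraMap K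
  have hD₁ : ∀ x : K, D₁ x = W.mkQ (KaehlerDifferential.D C F x) := fun _ => rfl
  have := hs.isAlgebraic_field
  have h0 := D₁.apply_eq_zero_of_apply_algebraMap_eq_zero
    (E := IntermediateField.adjoin C (Set.range ((↑) : s → K))) (fun a => by
      obtain ⟨a, ha⟩ := a
      change D₁ a = 0
      induction ha using IntermediateField.adjoin_induction with
      | mem x hx =>
        obtain ⟨t, rfl⟩ := hx
        rw [hD₁, Submodule.mkQ_apply, Submodule.Quotient.mk_eq_zero]
        exact Submodule.subset_span ⟨t, rfl⟩
      | algebraMap c => exact D₁.map_algebraMap c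
      | add x y _ _ hx hy => rw [map_add, hx, hy, add_zero]
      | inv x _ hx => rw [Derivation.leibniz_inv, hx, smul_zero]
      | mul x y _ _ hx hy => rw [Derivation.leibniz, hx, hy, smul_zero, smul_zero, add_zero])
    ⟨x, hx⟩
  rwa [hD₁, Submodule.mkQ_apply, Submodule.Quotient.mk_eq_zero] at h0

theorem Derivation.inv_smul_apply_prod_zpow {V : Type*} [AddCommGroup V] [Module C V] [Module F V]
    (D : Derivation C F V) {ι : Type*} (s : Finset ι) (z : ι → F) (hz : ∀ i, z i ≠ 0) (m : ι → ℤ) :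
    (∏ i ∈ s, z i ^ m i)⁻¹ • D (∏ i ∈ s, z i ^ m i) = ∑ i ∈ s, m i • (z i)⁻¹ • D (z i) := by
  classical
  induction s using Finset.induction_on with
  | empty => simp
  | insert i s hi ih =>
    have h1 : z i ^ m i ≠ 0 := zpow_ne_zero _ (hz i)
    have h2 : ∏ j ∈ s, z j ^ m j ≠ 0 := Finset.prod_ne_zero_iff.2 fun j _ => zpow_ne_zero _ (hz j)
    have h3 : (z i ^ m i)⁻¹ • D (z i ^ m i) = m i • (z i)⁻¹ • D (z i) := by
      rw [leibniz_zpow, smul_comm, smul_smul, zpow_sub_one₀ (hz i), inv_mul_cancel_left₀ h1]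
    rw [Finset.prod_insert hi, Finset.sum_insert hi, ← ih, ← h3, leibniz, smul_add, smul_smul,
      smul_smul, mul_inv_rev, inv_mul_cancel_right₀ h1, mul_right_comm, inv_mul_cancel₀ h2,
      one_mul, add_comm]

/-- Ax's theorem for a field with one derivation. -/
theorem Derivation.add_one_le_trdeg_adjoin [CharZero F] (D : Derivation C F F)
    (hC : ∀ x, D x = 0 → ∃ c, algebraMap C F c = x) {n : ℕ} (hn : 1 ≤ n) (y z : Fin n → F)
    (hz : ∀ i, z i ≠ 0) (hyz : ∀ i, D (z i) = z i * D (y i))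
    (hind : ∀ m : Fin n → ℤ, D (∑ i, m i • y i) = 0 → m = 0) :
    ((n + 1 : ℕ) : Cardinal) ≤
      Algebra.trdeg C (IntermediateField.adjoin C (Set.range y ∪ Set.range z)) := by
  classical
  by_contra hlt
  have hle : Algebra.trdeg C (IntermediateField.adjoin C (Set.range y ∪ Set.range z)) ≤ n := by
    rw [not_le, Nat.cast_succ, ← Cardinal.succ_natCast, Order.lt_succ_iff] at hlt
    exact hlt
  obtain ⟨W, _, hWn, hW⟩ := exists_submodule_finrank_le_trdeg _ hle
  have hyW : ∀ i, KaehlerDifferential.D C F (y i) ∈ W := fun i =>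
    hW _ (IntermediateField.subset_adjoin C _ (Or.inl ⟨i, rfl⟩))
  have hzW : ∀ i, KaehlerDifferential.D C F (z i) ∈ W := fun i =>
    hW _ (IntermediateField.subset_adjoin C _ (Or.inr ⟨i, rfl⟩))
  let ω : Fin n → Ω[F⁄C] := fun i =>
    (z i)⁻¹ • KaehlerDifferential.D C F (z i) - KaehlerDifferential.D C F (y i)
  have hdep : ¬ LinearIndependent F ω := by
    intro hω
    let W' := W ⊓ LinearMap.ker D.liftKaehlerDifferential
    have hωW : ∀ i, ω i ∈ W' := fun i => by
      refine ⟨W.sub_mem (W.smul_mem _ (hzW i)) (hyW i), ?_⟩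
      simp [ω, Derivation.liftKaehlerDifferential_comp_D, hyz, hz]
    -- `W'` misses the differential of `y 0`, so its dimension is below `n`.
    have hlt : W' < W := by
      refine lt_of_le_of_ne inf_le_left fun heq => ?_
      have h0 : D (y ⟨0, hn⟩) = 0 := by
        have := (heq.ge (hyW ⟨0, hn⟩)).2
        simpa [Derivation.liftKaehlerDifferential_comp_D] using this
      have := hind (Pi.single ⟨0, hn⟩ 1) (by simpa [Pi.single_apply, ite_smul] using h0)
      simpa using congrFun this ⟨0, hn⟩
    have h1 : Module.finrank F W' < Module.finrank F W := Submodule.finrank_lt_finrank_of_lt hlt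
    have : FiniteDimensional F W' := Submodule.finiteDimensional_of_le hlt.le
    have h2 : LinearIndependent F fun i => (⟨ω i, hωW i⟩ : W') :=
      LinearIndependent.of_comp W'.subtype hω
    have h3 := h2.fintype_card_le_finrank
    rw [Fintype.card_fin] at h3
    omega
  obtain ⟨a, ha0, ha, haD⟩ := exists_relation_const_coeff D ω
    (sum_derivation_smul_logForm_eq_zero D y z hz hyz) hdep
  choose c hc using fun i => hC _ (haD i)
  -- a basis of the group generated by the coefficients
  let Λ := Submodule.span ℤ (Set.range c)
  have : Module.Finite ℤ Λ := Module.Finite.span_of_finite ℤ (Set.finite_range c)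
  have : CharZero C := (algebraMap C F).charZero
  let b := Module.Free.chooseBasis ℤ Λ
  let e := fun j => (b j : C)
  have he : LinearIndependent ℤ e := b.linearIndependent.map' Λ.subtype (Submodule.ker_subtype _)
  let c' : Fin n → Λ := fun i => ⟨c i, Submodule.subset_span ⟨i, rfl⟩⟩
  let m := fun i j => b.repr (c' i) j
  have hm : ∀ i, c i = ∑ j, m i j • e j := fun i => by
    have := congrArg Λ.subtype (b.sum_repr (c' i))
    rw [map_sum] at this
    exact this.symm
  let w := fun j => ∏ i, z i ^ m i j
  have hw : ∀ j, w j ≠ 0 := fun j => Finset.prod_ne_zero_iff.2 fun i _ => zpow_ne_zero _ (hz i)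
  have halg := isAlgebraic_of_sum_logForm_exact e he w hw (∑ i, a i * y i) (by
    have h1 : KaehlerDifferential.D C F (∑ i, a i * y i) =
        ∑ i, a i • KaehlerDifferential.D C F (y i) := by
      rw [map_sum]
      refine Finset.sum_congr rfl fun i _ => ?_
      rw [← hc, Derivation.leibniz, Derivation.map_algebraMap, smul_zero, add_zero]
    have h2 : ∑ i, a i • (z i)⁻¹ • KaehlerDifferential.D C F (z i) =
        ∑ i, a i • KaehlerDifferential.D C F (y i) := by
      simpa [ω, smul_sub, Finset.sum_sub_distrib, sub_eq_zero] using ha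
    rw [h1, ← h2]
    simp_rw [w, Derivation.inv_smul_apply_prod_zpow _ _ _ hz, Finset.smul_sum]
    rw [Finset.sum_comm]
    refine Finset.sum_congr rfl fun i _ => ?_
    rw [← hc, hm, map_sum, Finset.sum_smul]
    refine Finset.sum_congr rfl fun j _ => ?_
    rw [map_zsmul, smul_comm, smul_assoc])
  -- `D` kills the algebraic element `w j`, and its logarithmic derivative is `D (∑ i, m i j • y
  -- i)`.
  have hm0 : ∀ j, (fun i => m i j) = 0 := fun j => by
    apply hind
    have h1 := D.inv_smul_apply_prod_zpow Finset.univ z hz fun i => m i j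
    rw [show D (∏ i, z i ^ m i j) = 0 from D.apply_eq_zero_of_isAlgebraic (halg j),
      smul_zero] at h1
    rw [map_sum, h1]
    refine Finset.sum_congr rfl fun i _ => ?_
    rw [map_zsmul, hyz, smul_eq_mul, inv_mul_cancel_left₀ (hz i)]
  refine ha0 (funext fun i => ?_)
  rw [← hc, hm, Finset.sum_eq_zero fun j _ => ?_, map_zero, Pi.zero_apply]
  rw [show m i j = 0 from congrFun (hm0 j) i, zero_smul]

end

/-! ### Application to germs and Hardy fields. -/

namespace RealGerm

theorem HasDeriv.exp {f g : RealGerm} (h : HasDeriv f g) :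
    HasDeriv (RealGerm.exp f) (RealGerm.exp f * g) := by
  obtain ⟨F, G, rfl, rfl, h⟩ := h
  refine ⟨fun x => Real.exp (F x), fun x => Real.exp (F x) * G x, rfl, rfl, ?_⟩
  filter_upwards [h] with x hx
  exact hx.exp

theorem exp_ne_zero (f : RealGerm) : RealGerm.exp f ≠ 0 := by
  induction f using Germ.inductionOn with
  | _ F =>
    intro h
    obtain ⟨x, hx⟩ := (Germ.coe_eq.1 h).exists
    exact Real.exp_ne_zero (F x) hx

/-- A germ with derivative zero is constant. -/
theorem HasDeriv.exists_eq_const {f : RealGerm} (h : HasDeriv f 0) :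
    ∃ d : ℝ, f = Germ.const d := by
  obtain ⟨F, G, rfl, hG, h⟩ := h
  have h0 : ∀ᶠ x in atTop, HasDerivAt F 0 x := by
    filter_upwards [h, Germ.coe_eq.1 hG] with x hx hx0
    rwa [← hx0] at hx
  obtain ⟨a, ha⟩ := eventually_atTop.1 h0
  refine ⟨F a, Germ.coe_eq.2 ?_⟩
  filter_upwards [eventually_ge_atTop a] with x hx
  refine constant_of_has_deriv_right_zero (fun y hy => (ha y hy.1).continuousAt.continuousWithinAt)
    (fun y hy => (ha y hy.1).hasDerivWithinAt) x ⟨hx, le_rfl⟩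

/-- A germ with derivative zero and a limit is the constant germ of its limit. -/
theorem HasDeriv.eq_const_of_tendsto {f : RealGerm} (h : HasDeriv f 0) {c : ℝ}
    (hc : f.Tendsto (𝓝 c)) : f = Germ.const c := by
  obtain ⟨d, rfl⟩ := h.exists_eq_const
  have h1 : Tendsto (fun _ : ℝ => d) atTop (𝓝 c) := hc
  rw [tendsto_nhds_unique tendsto_const_nhds h1]

theorem tendsto_sum_zsmul {ι : Type*} (s : Finset ι) (m : ι → ℤ) (f : ι → RealGerm) (c : ι → ℝ)
    (h : ∀ i, (f i).Tendsto (𝓝 (c i))) :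
    (∑ i ∈ s, m i • f i).Tendsto (𝓝 (∑ i ∈ s, m i • c i)) := by
  classical
  choose F hF using fun i => Quotient.exists_rep (f i)
  have hF' : ∀ i, f i = (F i : RealGerm) := fun i => (hF i).symm
  have hsum : ∑ i ∈ s, m i • f i = ((∑ i ∈ s, m i • F i : ℝ → ℝ) : RealGerm) := by
    induction s using Finset.induction_on with
    | empty => rfl
    | insert i s hi ih =>
      rw [Finset.sum_insert hi, Finset.sum_insert hi, ih, hF' i]
      rfl
  rw [hsum, Germ.coe_tendsto]
  simp only [Finset.sum_fn, Pi.smul_apply]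
  refine tendsto_finsetSum s fun i _ => ?_
  have h1 : Tendsto (F i) atTop (𝓝 (c i)) := by
    rw [← Germ.coe_tendsto, ← hF' i]
    exact h i
  exact h1.const_smul (m i)

end RealGerm

namespace HardyField

instance (H : HardyField) : CharZero H where
  cast_injective m n h := by
    have h1 : ((m : RealGerm)) = n := by
      have := congrArg Subtype.val h
      simpa using this
    have h2 : ((fun _ => (m : ℝ) : ℝ → ℝ) : RealGerm) = ((fun _ => (n : ℝ) : ℝ → ℝ) : RealGerm) := h1
    obtain ⟨x, hx⟩ := (Germ.coe_eq.1 h2).exists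
    exact Nat.cast_injective hx

/-- The derivative of an element of a Hardy field. -/
noncomputable def deriv (H : HardyField) (f : H) : H :=
  ⟨(H.exists_hasDeriv f f.2).choose, (H.exists_hasDeriv f f.2).choose_spec.1⟩

theorem hasDeriv_deriv (H : HardyField) (f : H) :
    RealGerm.HasDeriv (f : RealGerm) (H.deriv f : RealGerm) :=
  (H.exists_hasDeriv f f.2).choose_spec.2

theorem deriv_eq {H : HardyField} {f g : H} (h : RealGerm.HasDeriv (f : RealGerm) (g : RealGerm)) :
    H.deriv f = g :=
  Subtype.ext ((H.hasDeriv_deriv f).unique h)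

theorem deriv_mul {H : HardyField} (f g : H) :
    H.deriv (f * g) = f * H.deriv g + g * H.deriv f := by
  have h : H.deriv (f * g) = H.deriv f * g + f * H.deriv g :=
    deriv_eq ((H.hasDeriv_deriv f).mul (H.hasDeriv_deriv g))
  rw [h]
  ring

/-- The derivation of a Hardy field. -/
noncomputable def derivation (H : HardyField) : Derivation H.constants H H :=
  Derivation.mk'
    { toFun := H.deriv
      map_add' := fun f g => deriv_eq ((H.hasDeriv_deriv f).add (H.hasDeriv_deriv g))
      map_smul' := fun c f => by
        have hc : H.deriv (c : H) = 0 := deriv_eq c.2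
        rw [RingHom.id_apply, Algebra.smul_def, Algebra.smul_def, deriv_mul]
        change _ + f * H.deriv (c : H) = _
        rw [hc, mul_zero, add_zero] }
    deriv_mul

theorem derivation_apply (H : HardyField) (f : H) : H.derivation f = H.deriv f := rfl

end HardyField

theorem mainTheorem5 (H : HardyField) (hH : H.IsExponential)
    (n : ℕ) (hn : 1 ≤ n) (f : Fin n → H) (c : Fin n → ℝ)
    (hlim : ∀ i, (f i : RealGerm).Tendsto (𝓝 (c i)))
    (hind : LinearIndependent ℚ fun i => (f i : RealGerm) - Germ.const (c i)) :
    ((n + 1 : ℕ) : Cardinal) ≤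
      Algebra.trdeg H.constants
        (IntermediateField.adjoin H.constants
          (Set.range f ∪ Set.range fun i => hH.exp (f i))) := by
  refine H.derivation.add_one_le_trdeg_adjoin (fun x hx => ?_) hn f (fun i => hH.exp (f i))
    (fun i h0 => RealGerm.exp_ne_zero (f i : RealGerm) (congrArg Subtype.val h0))
    (fun i => HardyField.deriv_eq (H.hasDeriv_deriv (f i)).exp) fun m hm => ?_
  · refine ⟨⟨x, ?_⟩, rfl⟩
    have := H.hasDeriv_deriv x
    rwa [← H.derivation_apply, hx] at this
  -- A combination with zero derivative equals its limit `∑ m i • c i`, which is an integer relation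
  -- between the `f i - c i`.
  · have h0 : RealGerm.HasDeriv (∑ i, m i • (f i : RealGerm)) 0 := by
      have := H.hasDeriv_deriv (∑ i, m i • f i)
      rw [← H.derivation_apply, hm] at this
      simpa using this
    have h1 := h0.eq_const_of_tendsto (RealGerm.tendsto_sum_zsmul Finset.univ m _ c hlim)
    have h2 : (Germ.const (∑ i, m i • c i) : RealGerm) = ∑ i, m i • Germ.const (c i) := by
      have := map_sum (Germ.coeRingHom (R := ℝ) (atTop : Filter ℝ))
        (fun i => m i • (fun _ => c i : ℝ → ℝ)) Finset.univ
      simp only [map_zsmul] at this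
      refine Eq.trans ?_ this
      refine congrArg (fun F : ℝ → ℝ => (F : RealGerm)) ?_
      ext x
      simp
    have h3 := Fintype.linearIndependent_iff.1 (hind.restrict_scalars' ℤ) m (by
      simp_rw [smul_sub, Finset.sum_sub_distrib]
      rw [h1, h2, sub_self])
    exact funext h3
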